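/- Let $d\in\mathbb{N}$ and let $X_1,\dots,X_d$ be arbitrary real-valued random variables on a probability space (no integrability is assumed). Let $(X_1^{\rm co},\dots,X_d^{\rm co})$ be a comonotonic version of $(X_1,\dots,X_d)$, possibly defined on another probability space; that is, $X_i^{\rm co}$ has the same distribution as $X_i$ for every $i$, and for all $i\neq j$ there are a real random variable $Z$ and nondecreasing functions $f,g:\mathbb{R}\to\mathbb{R}$ with $X_i^{\rm co}=f(Z)$ and $X_j^{\rm co}=g(Z)$ almost surely. Then $$X_1+\cdots+X_d\ \leq_{\rm cx}\ X_1^{\rm co}+\cdots+X_d^{\rm co}.$$ Here $X\leq_{\rm cx}Y$ means that $\mathbb{E}[u(X)]\leq\mathbb{E}[u(Y)]$ in $[-\infty,\infty]$ for every convex function $u:\mathbb{R}\to\mathbb{R}$ such that both expectations are well-defined, where $\mathbb{E}[V]$ is called well-defined if $\mathbb{E}[\max\{V,0\}]<\infty$ or $\mathbb{E}[\max\{-V,0\}]<\infty$. -/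

import Mathlib

open MeasureTheory ProbabilityTheory
open scoped ENNReal

noncomputable section

namespace CxOrder

/-- `E[X₊]`, as an extended nonnegative number. -/
def expPos {Ω : Type*} [MeasurableSpace Ω] (X : Ω → ℝ) (P : Measure Ω) : ℝ≥0∞ :=
  ∫⁻ ω, ENNReal.ofReal (max (X ω) 0) ∂P

/-- `E[X₋]`, as an extended nonnegative number. -/
def expNeg {Ω : Type*} [MeasurableSpace Ω] (X : Ω → ℝ) (P : Measure Ω) : ℝ≥0∞ :=
  ∫⁻ ω, ENNReal.ofReal (max (-X ω) 0) ∂P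

/-- The expectation `E[X]` is well-defined: `E[X₊] < ∞` or `E[X₋] < ∞`. -/
def ExpWellDefined {Ω : Type*} [MeasurableSpace Ω] (X : Ω → ℝ) (P : Measure Ω) : Prop :=
  expPos X P < ∞ ∨ expNeg X P < ∞

/-- The expectation `E[X] = E[X₊] - E[X₋]` with values in `[-∞, ∞]`; meaningful when
`ExpWellDefined X P` holds (then `∞ - ∞` does not occur). -/
def expectation {Ω : Type*} [MeasurableSpace Ω] (X : Ω → ℝ) (P : Measure Ω) : EReal :=
  (expPos X P : EReal) - (expNeg X P : EReal)

/-- Convex order `X ≤_cx Y`: `E[u(X)] ≤ E[u(Y)]` for every convex `u : ℝ → ℝ` such that both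
expectations are well-defined (possibly infinite). The variables may live on different
probability spaces, since only their laws matter. -/
def ConvexOrder {Ω Ω' : Type*} [MeasurableSpace Ω] [MeasurableSpace Ω']
    (X : Ω → ℝ) (P : Measure Ω) (Y : Ω' → ℝ) (Q : Measure Ω') : Prop :=
  ∀ u : ℝ → ℝ, ConvexOn ℝ Set.univ u →
    ExpWellDefined (fun ω => u (X ω)) P → ExpWellDefined (fun ω => u (Y ω)) Q →
      expectation (fun ω => u (X ω)) P ≤ expectation (fun ω => u (Y ω)) Q

/-- The pair `(X, Y)` is comonotonic: almost surely `X = f(Z)` and `Y = g(Z)` for some random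
variable `Z` and increasing (i.e. nondecreasing) functions `f` and `g`. -/
def ComonotonicPair {Ω : Type*} [MeasurableSpace Ω] (X Y : Ω → ℝ) (P : Measure Ω) : Prop :=
  ∃ (Z : Ω → ℝ) (f g : ℝ → ℝ), AEMeasurable Z P ∧ Monotone f ∧ Monotone g ∧
    (∀ᵐ ω ∂P, X ω = f (Z ω)) ∧ (∀ᵐ ω ∂P, Y ω = g (Z ω))

/-- A random vector is comonotonic if its components are pairwise comonotonic. -/
def Comonotonic {Ω ι : Type*} [MeasurableSpace Ω] (X : ι → Ω → ℝ) (P : Measure Ω) : Prop :=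
  ∀ i j, i ≠ j → ComonotonicPair (X i) (X j) P

/-- `X'` is a comonotonic version of `X`: it is comonotonic, and has the same marginal laws. -/
structure IsComonotonicVersion {Ω Ω' ι : Type*} [MeasurableSpace Ω] [MeasurableSpace Ω']
    (X' : ι → Ω' → ℝ) (Q : Measure Ω') (X : ι → Ω → ℝ) (P : Measure Ω) : Prop where
  comonotonic : Comonotonic X' Q
  identDistrib : ∀ i, IdentDistrib (X i) (X' i) P Q

end CxOrder

end

/-! If `∑ τ i = t`, subadditivity of the positive part gives `(∑ x i - t)₊ ≤ ∑ (x i - τ i)₊`, and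
the expectation of the right side depends only on the marginals. A comonotonic vector lives almost
surely on a chain, and `exists_sum_eq_comparable` finds such a `τ` comparable with the whole chain;
there the differences `x i - τ i` share a sign and equality holds. This is
`IsComonotonicVersion.stopLoss_sum_le`, which applies to the negated vectors too.

Nonnegative convex functions are, up to a small error, mixtures of `(x - t)₊` and `(-x - t)₊`, so
`lintegral_convex_le` extends the inequality to them. With no integrability, a general convex `u` is
reached through `(u - c)₊`, letting `c → -∞` (`expectation_le_of_stopLoss_le`). -/

namespace CxOrder

open Set Filter Topology

/-! ### Chains in `ι → ℝ` -/

/-- A chain in `ι → ℝ` whose coordinate sums are at most `t` has a least upper bound whose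
coordinate sum is at most `t`. -/
theorem exists_isLUB_sum_le {ι : Type*} [Fintype ι] {L : Set (ι → ℝ)} (hL : IsChain (· ≤ ·) L)
    (hne : L.Nonempty) {t : ℝ} (ht : ∀ x ∈ L, ∑ i, x i ≤ t) :
    ∃ a, IsLUB L a ∧ ∑ i, a i ≤ t := by
  obtain ⟨x₀, hx₀⟩ := hne
  have hbdd : BddAbove L := by
    -- Above `x₀` no coordinate decreases, so one coordinate gains at most the total gain `t - ∑
    -- x₀`.
    refine ⟨fun i => x₀ i + (t - ∑ j, x₀ j), fun x hx i => ?_⟩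
    rcases hL.total hx hx₀ with h | h
    · have := ht x₀ hx₀
      have := h i
      dsimp only
      linarith
    · have h1 : x i - x₀ i ≤ ∑ j, (x j - x₀ j) :=
        Finset.single_le_sum (f := fun j => x j - x₀ j) (fun j _ => sub_nonneg.2 (h j))
          (Finset.mem_univ i)
      rw [Finset.sum_sub_distrib] at h1
      have := ht x hx
      dsimp only
      linarith
  have : Nonempty L := ⟨⟨x₀, hx₀⟩⟩
  have : IsDirectedOrder L := ⟨fun x y => by
    rcases hL.total x.2 y.2 with h | h
    · exact ⟨y, h, le_rfl⟩
    · exact ⟨x, le_rfl, h⟩⟩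
  have hlub := isLUB_csSup ⟨x₀, hx₀⟩ hbdd
  refine ⟨sSup L, hlub, ?_⟩
  refine le_of_tendsto (f := fun x : L => ∑ i, (x : ι → ℝ) i) (x := atTop)
    (tendsto_finsetSum _ fun i _ => ?_) (Eventually.of_forall fun x => ht x x.2)
  have hi := isLUB_pi.1 hlub i
  rw [image_eq_range] at hi
  exact tendsto_atTop_isLUB (fun _ _ h => h i) hi

/-- A chain in `ι → ℝ` whose coordinate sums are at least `t` has a greatest lower bound whose
coordinate sum is at least `t`. -/
theorem exists_isGLB_le_sum {ι : Type*} [Fintype ι] {L : Set (ι → ℝ)} (hL : IsChain (· ≤ ·) L)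
    (hne : L.Nonempty) {t : ℝ} (ht : ∀ x ∈ L, t ≤ ∑ i, x i) :
    ∃ a, IsGLB L a ∧ t ≤ ∑ i, a i := by
  obtain ⟨a, ha, hs⟩ := exists_isLUB_sum_le (L := -L) (t := -t)
    (fun x hx y hy hxy => by
      rcases hL.total hx hy with h | h
      · exact Or.inr (neg_le_neg_iff.1 h)
      · exact Or.inl (neg_le_neg_iff.1 h))
    hne.neg (fun x hx => by
      have := ht _ hx
      simp only [Pi.neg_apply, Finset.sum_neg_distrib] at this
      linarith)
  refine ⟨-a, by simpa using ha.neg, ?_⟩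
  simp only [Pi.neg_apply, Finset.sum_neg_distrib]
  linarith

/-- Every chain in `ι → ℝ` and every `t` admit a vector with coordinate sum `t` that is comparable
with all elements of the chain. -/
theorem exists_sum_eq_comparable {ι : Type*} [Fintype ι] [Nonempty ι] {C : Set (ι → ℝ)}
    (hC : IsChain (· ≤ ·) C) (t : ℝ) :
    ∃ τ : ι → ℝ, ∑ i, τ i = t ∧ ∀ x ∈ C, x ≤ τ ∨ τ ≤ x := by
  set L : Set (ι → ℝ) := {x ∈ C | ∑ i, x i ≤ t} with hLdef
  set U : Set (ι → ℝ) := {x ∈ C | t < ∑ i, x i} with hUdef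
  have hLC : IsChain (· ≤ ·) L := hC.mono (sep_subset _ _)
  have hUC : IsChain (· ≤ ·) U := hC.mono (sep_subset _ _)
  have hcov : ∀ x ∈ C, x ∈ L ∨ x ∈ U := fun x hx =>
    (le_or_gt (∑ i, x i) t).imp (fun h => ⟨hx, h⟩) fun h => ⟨hx, h⟩
  suffices H : ∃ τ : ι → ℝ, ∑ i, τ i = t ∧ τ ∈ upperBounds L ∧ τ ∈ lowerBounds U by
    obtain ⟨τ, h1, h2, h3⟩ := H
    exact ⟨τ, h1, fun x hx => (hcov x hx).imp (fun h => h2 h) fun h => h3 h⟩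
  have hcard : (Fintype.card ι : ℝ) ≠ 0 := by simp
  -- If `L` or `U` is empty, only one bound constrains `τ`, and the missing sum is spread equally
  -- over the coordinates.
  have hshift : ∀ a : ι → ℝ, ∑ i, (a i + (t - ∑ j, a j) / Fintype.card ι) = t := fun a => by
    rw [Finset.sum_add_distrib, Finset.sum_const, Finset.card_univ, nsmul_eq_mul]
    field_simp
    ring
  rcases L.eq_empty_or_nonempty with hLe | hLne
  · rcases U.eq_empty_or_nonempty with hUe | hUne
    · exact ⟨_, hshift 0, by simp [hLe], by simp [hUe]⟩
    · obtain ⟨b, hb, hbt⟩ := exists_isGLB_le_sum hUC hUne fun x hx => hx.2.le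
      refine ⟨_, hshift b, by simp [hLe], fun x hx i => ?_⟩
      have h1 := hb.1 hx i
      have h2 : (t - ∑ j, b j) / Fintype.card ι ≤ 0 :=
        div_nonpos_of_nonpos_of_nonneg (by linarith) (by positivity)
      dsimp only
      linarith
  · obtain ⟨a, ha, hat⟩ := exists_isLUB_sum_le hLC hLne fun x hx => hx.2
    rcases U.eq_empty_or_nonempty with hUe | hUne
    · refine ⟨_, hshift a, fun x hx i => ?_, by simp [hUe]⟩
      have h1 := ha.1 hx i
      have h2 : 0 ≤ (t - ∑ j, a j) / Fintype.card ι := div_nonneg (by linarith) (by positivity)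
      dsimp only
      linarith
    · obtain ⟨b, hb, hbt⟩ := exists_isGLB_le_sum hUC hUne fun x hx => hx.2.le
      have hab : a ≤ b := by
        refine ha.2 fun x hx => hb.2 fun y hy => ?_
        rcases hC.total hx.1 hy.1 with h | h
        · exact h
        · exact absurd (Finset.sum_le_sum fun i _ => h i) (not_le.2 (hx.2.trans_lt hy.2))
      -- Every point of the segment from `a = sup L` to `b = inf U` separates `L` from `U`; one of
      -- them has sum `t`.
      have hcont : ContinuousOn (fun θ : ℝ => ∑ i, (a i + θ * (b i - a i))) (Icc 0 1) := by
        fun_prop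
      obtain ⟨θ, hθ, hθt⟩ := intermediate_value_Icc zero_le_one hcont
        (show t ∈ Icc _ _ from ⟨by simpa using hat, by simpa using hbt⟩)
      refine ⟨fun i => a i + θ * (b i - a i), hθt, fun x hx i => ?_, fun x hx i => ?_⟩
      · have h1 := ha.1 hx i
        have h2 := mul_nonneg hθ.1 (sub_nonneg.2 (hab i))
        dsimp only
        linarith
      · have h1 := hb.1 hx i
        have h2 := mul_nonneg (sub_nonneg.2 hθ.2) (sub_nonneg.2 (hab i))
        dsimp only
        linarith

/-! ### Convex functions as mixtures -/

/-- A convex function vanishing on a left half-line is a mixture of the functions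
`x ↦ (x - t)₊`. -/
theorem exists_measure_ofReal_eq_lintegral {w : ℝ → ℝ} (hw : ConvexOn ℝ univ w)
    {m : ℝ} (hm : ∀ x ≤ m, w x = 0) :
    ∃ μ : Measure ℝ, SFinite μ ∧
      ∀ x, ENNReal.ofReal (w x) = ∫⁻ t, ENNReal.ofReal (x - t) ∂μ := by
  set g : ℝ → ℝ := fun x => derivWithin w (Ioi x) x with hg
  have hgmono : Monotone g := by
    have := hw.monotoneOn_rightDeriv
    rwa [interior_univ, monotoneOn_univ] at this
  have hderiv : ∀ x, HasDerivWithinAt w (g x) (Ioi x) x := fun x =>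
    hw.hasDerivWithinAt_rightDeriv_of_mem_interior (by simp)
  have hcont : Continuous w := by
    rw [← continuousOn_univ]
    exact hw.continuousOn isOpen_univ
  have hg0 : ∀ x < m, g x = 0 := fun x hx => by
    have h0 : HasDerivWithinAt w 0 (Ioi x) x := by
      refine ((hasDerivAt_const x (0 : ℝ)).congr_of_eventuallyEq ?_).hasDerivWithinAt
      filter_upwards [Iio_mem_nhds hx] with y hy using hm y (le_of_lt hy)
    exact h0.derivWithin (uniqueDiffWithinAt_Ioi x)
  -- The mixing measure is the second derivative of `w`: the Stieltjes measure of its right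
  -- derivative, made right-continuous.
  set F := hgmono.stieltjesFunction with hF
  have hFg : ∀ᵐ x, F x = g x := by
    have : ∀ᵐ x, x ∉ {x | ¬ ContinuousAt g x} :=
      measure_eq_zero_iff_ae_notMem.1 (hgmono.countable_not_continuousAt.measure_zero _)
    filter_upwards [this] with x hx
    rw [hF, hgmono.stieltjesFunction_eq]
    exact (not_not.1 hx).continuousWithinAt.rightLim_eq
  have hlim : Tendsto F atBot (𝓝 0) := by
    refine tendsto_const_nhds.congr' ?_
    filter_upwards [Iio_mem_atBot m] with x hx
    rw [hF, hgmono.stieltjesFunction_eq, ← hg0 x hx]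
    have : ContinuousAt g x := by
      refine (continuousAt_const (y := (0 : ℝ))).congr ?_
      filter_upwards [Iio_mem_nhds hx] with y hy using (hg0 y hy).symm
    exact this.continuousWithinAt.rightLim_eq.symm
  have hgnn : ∀ x, 0 ≤ g x := fun x => by
    rcases lt_or_ge x m with h | h
    · exact (hg0 x h).ge
    · rw [← hg0 (m - 1) (by linarith)]
      exact hgmono (by linarith)
  refine ⟨F.measure, inferInstance, fun x => ?_⟩
  -- `(x - t)₊` is the length of `[t, x)`; Tonelli then turns the mixture into `∫ F` over `s < x`,
  -- which is `w x`.
  have h1 : ∀ t, ENNReal.ofReal (x - t) =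
      ∫⁻ s, {p : ℝ × ℝ | p.1 ≤ p.2 ∧ p.2 < x}.indicator 1 (t, s) := fun t => by
    rw [← Real.volume_Ico, ← lintegral_indicator_one measurableSet_Ico]
    rfl
  have hmeas : MeasurableSet {p : ℝ × ℝ | p.1 ≤ p.2 ∧ p.2 < x} :=
    (measurableSet_le measurable_fst measurable_snd).inter
      (measurableSet_lt measurable_snd measurable_const)
  simp_rw [h1]
  rw [lintegral_lintegral_swap
    (f := fun t s => {p : ℝ × ℝ | p.1 ≤ p.2 ∧ p.2 < x}.indicator (1 : ℝ × ℝ → ℝ≥0∞) (t, s))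
    (measurable_one.indicator hmeas).aemeasurable]
  have h2 : ∀ s, ∫⁻ t, {p : ℝ × ℝ | p.1 ≤ p.2 ∧ p.2 < x}.indicator (1 : ℝ × ℝ → ℝ≥0∞) (t, s)
      ∂F.measure = (Iio x).indicator (fun s => ENNReal.ofReal (F s)) s := fun s => by
    by_cases hs : s < x
    · rw [indicator_of_mem (show s ∈ Iio x from hs), ← sub_zero (F s), ← F.measure_Iic hlim,
        ← lintegral_indicator_one measurableSet_Iic]
      refine lintegral_congr fun t => ?_
      simp [indicator_apply, hs]
    · rw [indicator_of_notMem (show s ∉ Iio x from hs)]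
      simp [hs]
  simp_rw [h2]
  rw [lintegral_indicator measurableSet_Iio]
  have h3 : ∫⁻ s in Iio x, ENNReal.ofReal (F s) = ∫⁻ s in Iio x, ENNReal.ofReal (g s) :=
    lintegral_congr_ae (ae_restrict_of_ae (hFg.mono fun s hs => by simp only [hs]))
  rw [h3]
  rcases le_total x m with hxm | hxm
  · rw [hm x hxm, setLIntegral_congr_fun (g := 0) measurableSet_Iio fun s hs => by
      simp [hg0 s (lt_of_lt_of_le hs hxm)]]
    simp
  · have h4 : ∫⁻ s in Iio x, ENNReal.ofReal (g s) = ∫⁻ s in Ioc m x, ENNReal.ofReal (g s) := by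
      rw [setLIntegral_congr (Iio_ae_eq_Iic (a := x)), ← Iic_union_Ioc_eq_Iic hxm,
        lintegral_union measurableSet_Ioc (by simp [Set.disjoint_left]; grind),
        setLIntegral_congr (Iio_ae_eq_Iic (a := m)).symm,
        setLIntegral_congr_fun (g := 0) measurableSet_Iio fun s hs => by simp [hg0 s hs]]
      simp
    have hint : IntervalIntegrable g volume m x := hgmono.intervalIntegrable
    rw [h4, ← ofReal_integral_eq_lintegral_ofReal (hint.1) (Eventually.of_forall hgnn),
      ← intervalIntegral.integral_of_le hxm,
      intervalIntegral.integral_eq_sub_of_hasDeriv_right_of_le hxm hcont.continuousOn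
        (fun y _ => hderiv y) hint, hm m le_rfl, sub_zero]

/-- Since `m` is a minimum, `w` is nondecreasing to its right, so composing with the convex `max ·
m` keeps convexity. This isolates the right branch of `w`. -/
theorem convexOn_comp_max {w : ℝ → ℝ} (hw : ConvexOn ℝ univ w) (hnn : ∀ x, 0 ≤ w x) {m : ℝ}
    (hm : w m = 0) : ConvexOn ℝ univ fun x => w (max x m) := by
  have hmono : ∀ x y, m ≤ x → x ≤ y → w x ≤ w y := fun x y hx hxy => by
    have := hw.le_max_of_mem_Icc (mem_univ m) (mem_univ y) ⟨hx, hxy⟩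
    rwa [hm, max_eq_right (hnn y)] at this
  refine ⟨convex_univ, fun x _ y _ a b ha hb hab => ?_⟩
  refine (hmono _ (a • max x m + b • max y m) (le_max_right _ _) (max_le ?_ ?_)).trans
    (hw.2 (mem_univ _) (mem_univ _) ha hb hab)
  · simp only [smul_eq_mul]
    gcongr <;> exact le_max_left _ _
  · calc m = a * m + b * m := by rw [← add_mul, hab, one_mul]
      _ ≤ _ := by
        simp only [smul_eq_mul]
        gcongr <;> exact le_max_right _ _

/-! ### From stop-loss order to convex order -/

section Expectation

variable {Ω Ω' : Type*} [MeasurableSpace Ω] [MeasurableSpace Ω'] {P : Measure Ω} {Q : Measure Ω'}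

/-- The stop-loss order passes to mixtures of the functions `x ↦ (x - t)₊`. -/
theorem lintegral_comp_max_le [SFinite P] [SFinite Q] {S : Ω → ℝ} {S' : Ω' → ℝ}
    (hS : AEMeasurable S P) (hS' : AEMeasurable S' Q)
    (h : ∀ t, ∫⁻ ω, ENNReal.ofReal (S ω - t) ∂P ≤ ∫⁻ ω, ENNReal.ofReal (S' ω - t) ∂Q)
    {w : ℝ → ℝ} (hw : ConvexOn ℝ univ w) (hnn : ∀ x, 0 ≤ w x) {m : ℝ} (hm : w m = 0) :
    ∫⁻ ω, ENNReal.ofReal (w (max (S ω) m)) ∂P ≤ ∫⁻ ω, ENNReal.ofReal (w (max (S' ω) m)) ∂Q := by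
  obtain ⟨μ, _, hμ⟩ := exists_measure_ofReal_eq_lintegral (convexOn_comp_max hw hnn hm) (m := m)
    fun x hx => by rw [max_eq_right hx, hm]
  simp_rw [hμ]
  rw [lintegral_lintegral_swap (f := fun ω t => ENNReal.ofReal (S ω - t)),
    lintegral_lintegral_swap (f := fun ω t => ENNReal.ofReal (S' ω - t))]
  · exact lintegral_mono h
  · exact (hS'.comp_fst.sub measurable_snd.aemeasurable).ennreal_ofReal
  · exact (hS.comp_fst.sub measurable_snd.aemeasurable).ennreal_ofReal

/-- A zero `m` splits `w` into a right branch, controlled by `h`, and a left branch, which after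
reflection is controlled by `h'`. -/
theorem lintegral_convex_le_of_eq_zero [SFinite P] [SFinite Q] {S : Ω → ℝ} {S' : Ω' → ℝ}
    (hS : AEMeasurable S P) (hS' : AEMeasurable S' Q)
    (h : ∀ t, ∫⁻ ω, ENNReal.ofReal (S ω - t) ∂P ≤ ∫⁻ ω, ENNReal.ofReal (S' ω - t) ∂Q)
    (h' : ∀ t, ∫⁻ ω, ENNReal.ofReal (-S ω - t) ∂P ≤ ∫⁻ ω, ENNReal.ofReal (-S' ω - t) ∂Q)
    {w : ℝ → ℝ} (hw : ConvexOn ℝ univ w) (hnn : ∀ x, 0 ≤ w x) {m : ℝ} (hm : w m = 0) :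
    ∫⁻ ω, ENNReal.ofReal (w (S ω)) ∂P ≤ ∫⁻ ω, ENNReal.ofReal (w (S' ω)) ∂Q := by
  have hcont : Continuous w := by
    rw [← continuousOn_univ]
    exact hw.continuousOn isOpen_univ
  have hneg : ConvexOn ℝ univ fun x => w (-x) := by
    exact hw.comp_linearMap (-LinearMap.id : ℝ →ₗ[ℝ] ℝ)
  have hsplit : ∀ x, ENNReal.ofReal (w x) =
      ENNReal.ofReal (w (max x m)) + ENNReal.ofReal (w (-max (-x) (-m))) := fun x => by
    rcases le_total x m with hx | hx
    · rw [max_eq_right hx, max_eq_left (neg_le_neg hx), hm, neg_neg]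
      simp
    · rw [max_eq_left hx, max_eq_right (neg_le_neg hx), neg_neg, hm]
      simp
  rw [lintegral_congr fun ω => hsplit (S ω), lintegral_congr fun ω => hsplit (S' ω)]
  rw [lintegral_add_left', lintegral_add_left']
  · exact add_le_add (lintegral_comp_max_le hS hS' h hw hnn hm)
      (lintegral_comp_max_le hS.neg hS'.neg h' hneg (fun x => hnn _) (by rwa [neg_neg]))
  · exact (hcont.measurable.comp_aemeasurable (hS'.max aemeasurable_const)).ennreal_ofReal
  · exact (hcont.measurable.comp_aemeasurable (hS.max aemeasurable_const)).ennreal_ofReal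

/-- Two-sided stop-loss order implies domination of the integrals of nonnegative convex
functions. -/
theorem lintegral_convex_le [IsProbabilityMeasure P] [IsProbabilityMeasure Q]
    {S : Ω → ℝ} {S' : Ω' → ℝ} (hS : AEMeasurable S P) (hS' : AEMeasurable S' Q)
    (h : ∀ t, ∫⁻ ω, ENNReal.ofReal (S ω - t) ∂P ≤ ∫⁻ ω, ENNReal.ofReal (S' ω - t) ∂Q)
    (h' : ∀ t, ∫⁻ ω, ENNReal.ofReal (-S ω - t) ∂P ≤ ∫⁻ ω, ENNReal.ofReal (-S' ω - t) ∂Q)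
    {w : ℝ → ℝ} (hw : ConvexOn ℝ univ w) (hnn : ∀ x, 0 ≤ w x) :
    ∫⁻ ω, ENNReal.ofReal (w (S ω)) ∂P ≤ ∫⁻ ω, ENNReal.ofReal (w (S' ω)) ∂Q := by
  refine ENNReal.le_of_forall_pos_le_add fun ε hε _ => ?_
  have hbdd : BddBelow (range w) := ⟨0, by rintro _ ⟨x, rfl⟩; exact hnn x⟩
  obtain ⟨m, hm⟩ := exists_lt_of_ciInf_lt
    (show ⨅ x, w x < (⨅ x, w x) + ε from lt_add_of_pos_right _ hε)
  set I := ⨅ x, w x with hI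
  have hI0 : 0 ≤ I := le_ciInf hnn
  have hIw : ∀ x, I ≤ w x := fun x => ciInf_le hbdd x
  -- The infimum need not be attained (as for `exp`); cutting at `I + ε` creates a zero at a cost of
  -- at most `ε`.
  set v : ℝ → ℝ := fun x => max (w x - (I + ε)) 0 with hv
  have hvconv : ConvexOn ℝ univ v :=
    (hw.sub (concaveOn_const _ convex_univ)).sup (convexOn_const 0 convex_univ)
  have key := lintegral_convex_le_of_eq_zero hS hS' h h' hvconv (fun x => le_max_right _ _)
    (m := m) (max_eq_right (by linarith))
  have hε0 : (0 : ℝ) ≤ ε := ε.2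
  calc ∫⁻ ω, ENNReal.ofReal (w (S ω)) ∂P
      ≤ ∫⁻ ω, (ENNReal.ofReal (v (S ω)) + ENNReal.ofReal (I + ε)) ∂P := by
        refine lintegral_mono fun ω => ?_
        rw [← ENNReal.ofReal_add (le_max_right _ _) (by positivity)]
        exact ENNReal.ofReal_le_ofReal (by linarith [le_max_left (w (S ω) - (I + ε)) 0])
    _ = ∫⁻ ω, ENNReal.ofReal (v (S ω)) ∂P + ENNReal.ofReal (I + ε) := by
        rw [lintegral_add_right _ measurable_const]
        simp
    _ ≤ ∫⁻ ω, ENNReal.ofReal (v (S' ω)) ∂Q + ENNReal.ofReal (I + ε) := by gcongr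
    _ = ∫⁻ ω, (ENNReal.ofReal (v (S' ω)) + ENNReal.ofReal (I + ε)) ∂Q := by
        rw [lintegral_add_right _ measurable_const]
        simp
    _ ≤ ∫⁻ ω, (ENNReal.ofReal (w (S' ω)) + ε) ∂Q := by
        refine lintegral_mono fun ω => ?_
        rw [← ENNReal.ofReal_add (le_max_right _ _) (by positivity),
          ← ENNReal.ofReal_coe_nnreal, ← ENNReal.ofReal_add (hnn _) hε0]
        refine ENNReal.ofReal_le_ofReal ?_
        have := hIw (S' ω)
        rw [← le_sub_iff_add_le]
        exact max_le (by linarith) (by linarith)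
    _ = ∫⁻ ω, ENNReal.ofReal (w (S' ω)) ∂Q + ε := by
        rw [lintegral_add_right _ measurable_const]
        simp

/-- Integrates the pointwise identity `(y + n)₊ + min y₋ n = n + y₊`; the truncation keeps the
negative part finite. -/
theorem lintegral_add_expNeg_truncation [IsProbabilityMeasure P] {Y : Ω → ℝ}
    (hY : AEMeasurable Y P) (n : ℕ) :
    ∫⁻ ω, ENNReal.ofReal (Y ω - -(n : ℝ)) ∂P +
      ∫⁻ ω, ENNReal.ofReal (min (max (-Y ω) 0) n) ∂P = n + expPos Y P := by
  have h1 : (n : ℝ≥0∞) = ∫⁻ _, ENNReal.ofReal n ∂P := by simp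
  rw [expPos, h1, ← lintegral_add_left' (f := fun ω => ENNReal.ofReal (Y ω - -(n : ℝ)))
      (hY.sub aemeasurable_const).ennreal_ofReal,
    ← lintegral_add_left measurable_const]
  refine lintegral_congr fun ω => ?_
  have hn : (0 : ℝ) ≤ n := n.cast_nonneg
  rw [← ENNReal.ofReal_add hn (le_max_right _ _)]
  rcases le_total 0 (Y ω) with h0 | h0
  · rw [max_eq_right (neg_nonpos.2 h0), max_eq_left h0, min_eq_left hn, ENNReal.ofReal_zero,
      add_zero]
    congr 1
    ring
  · rw [max_eq_left (neg_nonneg.2 h0), max_eq_right h0]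
    rcases le_total (-Y ω) n with h | h
    · rw [min_eq_left h, ← ENNReal.ofReal_add (by linarith) (by linarith)]
      congr 1
      ring
    · rw [min_eq_right h, ENNReal.ofReal_of_nonpos (by linarith), zero_add, add_zero]

theorem iSup_expNeg_truncation {Y : Ω → ℝ} (hY : AEMeasurable Y P) :
    ⨆ n : ℕ, ∫⁻ ω, ENNReal.ofReal (min (max (-Y ω) 0) n) ∂P = expNeg Y P := by
  rw [expNeg, ← lintegral_iSup']
  · refine lintegral_congr fun ω => le_antisymm (iSup_le fun n => ?_) ?_
    · exact ENNReal.ofReal_le_ofReal (min_le_left _ _)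
    · obtain ⟨n, hn⟩ := exists_nat_ge (max (-Y ω) 0)
      refine le_iSup_of_le n ?_
      rw [min_eq_left hn]
  · exact fun n => ((hY.neg.max aemeasurable_const).min aemeasurable_const).ennreal_ofReal
  · refine Eventually.of_forall fun ω n k hnk => ENNReal.ofReal_le_ofReal ?_
    exact min_le_min le_rfl (Nat.cast_le.2 hnk)

/-- If `E[(Y - c)₊] ≤ E[(Y' - c)₊]` for all `c`, then `E[Y] ≤ E[Y']` as soon as `E[Y']` is
well-defined. -/
theorem expectation_le_of_stopLoss_le [IsProbabilityMeasure P] [IsProbabilityMeasure Q]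
    {Y : Ω → ℝ} {Y' : Ω' → ℝ} (hY : AEMeasurable Y P) (hY' : AEMeasurable Y' Q)
    (h : ∀ c, ∫⁻ ω, ENNReal.ofReal (Y ω - c) ∂P ≤ ∫⁻ ω, ENNReal.ofReal (Y' ω - c) ∂Q)
    (hwd : ExpWellDefined Y' Q) : expectation Y P ≤ expectation Y' Q := by
  have hpos : expPos Y P ≤ expPos Y' Q := by
    simpa [expPos, ENNReal.ofReal_max] using h 0
  -- The desired inequality without subtraction: take `c = -n`, cancel `n`, let `n → ∞`.
  have hcross : expPos Y P + expNeg Y' Q ≤ expPos Y' Q + expNeg Y P := by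
    rw [← iSup_expNeg_truncation hY', ENNReal.add_iSup]
    refine iSup_le fun n => ?_
    have h1 := lintegral_add_expNeg_truncation hY n
    have h2 := lintegral_add_expNeg_truncation hY' n
    have h3 := (le_iSup (fun n : ℕ => ∫⁻ ω, ENNReal.ofReal (min (max (-Y ω) 0) n) ∂P) n).trans_eq
      (iSup_expNeg_truncation hY)
    refine le_trans ?_ (add_le_add_right h3 _)
    rw [← ENNReal.add_le_add_iff_left (ENNReal.natCast_ne_top n), ← add_assoc, ← add_assoc, ← h1,
      ← h2, add_right_comm]
    gcongr
    exact h _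
  unfold expectation
  unfold ExpWellDefined at hwd
  generalize expPos Y P = p at *
  generalize expPos Y' Q = p' at *
  generalize expNeg Y P = q at *
  generalize expNeg Y' Q = q' at *
  rcases eq_or_ne p' ∞ with hp' | hp'
  · subst hp'
    have hq' : q' ≠ ∞ := by simpa [lt_top_iff_ne_top] using hwd
    lift q' to NNReal using hq'
    have : ((∞ : ℝ≥0∞) : EReal) - ((q' : ℝ≥0∞) : EReal) = ⊤ := EReal.top_sub_coe (q' : ℝ)
    rw [this]
    exact le_top
  · have hp : p ≠ ∞ := ne_top_of_le_ne_top hp' hpos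
    rcases eq_or_ne q ∞ with hq | hq
    · subst hq
      simp
    · have hq' : q' ≠ ∞ := by
        intro hq'
        rw [hq', add_top, top_le_iff] at hcross
        exact ENNReal.add_ne_top.2 ⟨hp', hq⟩ hcross
      lift p to NNReal using hp
      lift p' to NNReal using hp'
      lift q to NNReal using hq
      lift q' to NNReal using hq'
      have h4 : (p : ℝ) + q' ≤ p' + q := by exact_mod_cast hcross
      have h5 : (p : ℝ) - q ≤ p' - q' := by linarith
      have h6 := EReal.coe_le_coe_iff.2 h5
      rw [EReal.coe_sub, EReal.coe_sub] at h6
      exact h6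

/-- Two-sided stop-loss order implies the convex order. -/
theorem convexOrder_of_stopLoss_le [IsProbabilityMeasure P] [IsProbabilityMeasure Q]
    {S : Ω → ℝ} {S' : Ω' → ℝ} (hS : AEMeasurable S P) (hS' : AEMeasurable S' Q)
    (h : ∀ t, ∫⁻ ω, ENNReal.ofReal (S ω - t) ∂P ≤ ∫⁻ ω, ENNReal.ofReal (S' ω - t) ∂Q)
    (h' : ∀ t, ∫⁻ ω, ENNReal.ofReal (-S ω - t) ∂P ≤ ∫⁻ ω, ENNReal.ofReal (-S' ω - t) ∂Q) :
    ConvexOrder S P S' Q := by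
  intro u hu _ hwd
  have hcont : Continuous u := by
    rw [← continuousOn_univ]
    exact hu.continuousOn isOpen_univ
  refine expectation_le_of_stopLoss_le (hcont.measurable.comp_aemeasurable hS)
    (hcont.measurable.comp_aemeasurable hS') (fun c => ?_) hwd
  have hw : ConvexOn ℝ univ fun x => max (u x - c) 0 :=
    (hu.sub (concaveOn_const _ convex_univ)).sup (convexOn_const 0 convex_univ)
  simpa [ENNReal.ofReal_max] using
    lintegral_convex_le hS hS' h h' hw fun x => le_max_right _ _

end Expectation

/-! ### Comonotonic vectors and their sums -/

section Comonotonic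

variable {Ω Ω' ι : Type*} [MeasurableSpace Ω] [MeasurableSpace Ω'] {P : Measure Ω} {Q : Measure Ω'}

/-- A comonotonic vector takes its values almost surely in a chain. -/
theorem Comonotonic.exists_isChain [Countable ι] {X : ι → Ω → ℝ} (hX : Comonotonic X P) :
    ∃ C : Set (ι → ℝ), IsChain (· ≤ ·) C ∧ ∀ᵐ ω ∂P, (fun i => X i ω) ∈ C := by
  choose Z f g _ hf hg hXf hXg using hX
  refine ⟨(fun ω i => X i ω) '' {ω | ∀ i j h, X i ω = f i j h (Z i j h ω) ∧
    X j ω = g i j h (Z i j h ω)}, ?_, ?_⟩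
  · rintro _ ⟨ω, hω, rfl⟩ _ ⟨ω', hω', rfl⟩ -
    -- Incomparable values give coordinates `i`, `j` that order `ω` and `ω'` oppositely, while both
    -- are nondecreasing in the same `Z i j`.
    by_contra hcon
    simp only [Pi.le_def, not_or, not_forall, not_le] at hcon
    obtain ⟨⟨i, hi⟩, j, hj⟩ := hcon
    have hij : i ≠ j := by
      rintro rfl
      exact lt_asymm hi hj
    rw [(hω i j hij).1, (hω' i j hij).1] at hi
    rw [(hω i j hij).2, (hω' i j hij).2] at hj
    exact lt_asymm ((hf i j hij).reflect_lt hi) ((hg i j hij).reflect_lt hj)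
  · have : ∀ᵐ ω ∂P, ∀ i j h, X i ω = f i j h (Z i j h ω) ∧ X j ω = g i j h (Z i j h ω) := by
      simp only [ae_all_iff]
      exact fun i j h => (hXf i j h).and (hXg i j h)
    exact this.mono fun ω hω => ⟨ω, hω, rfl⟩

theorem IsComonotonicVersion.neg {X : ι → Ω → ℝ} {X' : ι → Ω' → ℝ}
    (h : IsComonotonicVersion X' Q X P) :
    IsComonotonicVersion (fun i ω => -X' i ω) Q (fun i ω => -X i ω) P where
  comonotonic i j hij := by
    obtain ⟨Z, f, g, hZ, hf, hg, hXf, hXg⟩ := h.comonotonic i j hij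
    -- `-f` alone would be nonincreasing; negating `Z` as well restores monotonicity.
    refine ⟨fun ω => -Z ω, fun x => -f (-x), fun x => -g (-x), hZ.neg,
      fun x y hxy => neg_le_neg (hf (neg_le_neg hxy)),
      fun x y hxy => neg_le_neg (hg (neg_le_neg hxy)), ?_, ?_⟩
    · filter_upwards [hXf] with ω hω
      rw [hω, neg_neg]
    · filter_upwards [hXg] with ω hω
      rw [hω, neg_neg]
  identDistrib i := (h.identDistrib i).comp measurable_neg

/-- The stop-loss premiums of a sum are largest for the comonotonic version. -/
theorem IsComonotonicVersion.stopLoss_sum_le [Fintype ι] [IsProbabilityMeasure P]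
    [IsProbabilityMeasure Q] {X : ι → Ω → ℝ} {X' : ι → Ω' → ℝ}
    (h : IsComonotonicVersion X' Q X P) (t : ℝ) :
    ∫⁻ ω, ENNReal.ofReal (∑ i, X i ω - t) ∂P ≤ ∫⁻ ω, ENNReal.ofReal (∑ i, X' i ω - t) ∂Q := by
  cases isEmpty_or_nonempty ι
  · simp
  obtain ⟨C, hC, hXC⟩ := h.comonotonic.exists_isChain
  obtain ⟨τ, rfl, hτ⟩ := exists_sum_eq_comparable hC t
  calc ∫⁻ ω, ENNReal.ofReal (∑ i, X i ω - ∑ i, τ i) ∂P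
      ≤ ∫⁻ ω, ∑ i, ENNReal.ofReal (X i ω - τ i) ∂P := by
        refine lintegral_mono fun ω => ?_
        rw [← Finset.sum_sub_distrib]
        exact Finset.le_sum_of_subadditive _ ENNReal.ofReal_zero.le (fun _ _ => ENNReal.ofReal_add_le)
          _ _
    _ = ∑ i, ∫⁻ ω, ENNReal.ofReal (X i ω - τ i) ∂P :=
        lintegral_finsetSum' _ fun i _ =>
          ((h.identDistrib i).aemeasurable_fst.sub aemeasurable_const).ennreal_ofReal
    _ = ∑ i, ∫⁻ ω, ENNReal.ofReal (X' i ω - τ i) ∂Q :=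
        Finset.sum_congr rfl fun i _ =>
          ((h.identDistrib i).comp (u := fun x => ENNReal.ofReal (x - τ i))
            (by fun_prop)).lintegral_eq
    _ = ∫⁻ ω, ∑ i, ENNReal.ofReal (X' i ω - τ i) ∂Q :=
        (lintegral_finsetSum' _ fun i _ =>
          ((h.identDistrib i).aemeasurable_snd.sub aemeasurable_const).ennreal_ofReal).symm
    _ = ∫⁻ ω, ENNReal.ofReal (∑ i, X' i ω - ∑ i, τ i) ∂Q := by
        -- Comparability with `τ` gives all terms one sign, so subadditivity loses nothing here.
        refine lintegral_congr_ae ?_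
        filter_upwards [hXC] with ω hω
        rw [← Finset.sum_sub_distrib]
        rcases hτ _ hω with hle | hle
        · rw [ENNReal.ofReal_of_nonpos
            (Finset.sum_nonpos fun i _ => sub_nonpos.2 (hle i))]
          exact Finset.sum_eq_zero fun i _ => ENNReal.ofReal_of_nonpos (sub_nonpos.2 (hle i))
        · exact (ENNReal.ofReal_sum_of_nonneg fun i _ => sub_nonneg.2 (hle i)).symm

end Comonotonic

end CxOrder

theorem theorem5 (d : ℕ)
    {Ω : Type*} [MeasurableSpace Ω] (P : Measure Ω) [IsProbabilityMeasure P]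
    {Ω' : Type*} [MeasurableSpace Ω'] (Q : Measure Ω') [IsProbabilityMeasure Q]
    (X : Fin d → Ω → ℝ) (hX : ∀ i, AEMeasurable (X i) P)
    (Xco : Fin d → Ω' → ℝ) (hco : CxOrder.IsComonotonicVersion Xco Q X P) :
    CxOrder.ConvexOrder (fun ω => ∑ i, X i ω) P (fun ω => ∑ i, Xco i ω) Q := by
  refine CxOrder.convexOrder_of_stopLoss_le (Finset.aemeasurable_fun_sum _ fun i _ => hX i)
    (Finset.aemeasurable_fun_sum _ fun i _ => (hco.identDistrib i).aemeasurable_snd)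
    hco.stopLoss_sum_le fun t => ?_
  simpa only [Finset.sum_neg_distrib] using hco.neg.stopLoss_sum_le t
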